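/- Let $\mathbb{K}$ be $\mathbb{R}$ or $\mathbb{C}$. For a Banach space $X$ over $\mathbb{K}$ let $\mathcal{L}(X)$ be the space of bounded linear operators on $X$ and let $$\Pi(X)=\{(x,x^*)\in X\times X^* : \|x\|=\|x^*\|=x^*(x)=1\},\qquad v(T)=\sup\{|x^*(T(x))| : (x,x^*)\in\Pi(X)\}\quad (T\in\mathcal{L}(X)).$$ The norm of $X$ is called strongly subdifferentiable if, for every $x\in X$, the limit $\lim_{t\to0^+}\frac{1}{t}\left(\|x+th\|-\|x\|\right)$ exists uniformly for $h$ in the closed unit ball of $X$. The space $X$ has the property $\mathbf{L}_{p,p}$-nu if for every $\varepsilon>0$ and every $(x,x^*)\in\Pi(X)$ there is $\eta=\eta(\varepsilon,(x,x^*))>0$ such that, whenever $T\in\mathcal{L}(X)$ satisfies $v(T)=1$ and $|x^*(T(x))|>1-\eta$, there is $S\in\mathcal{L}(X)$ with $v(S)=1$, $|x^*(S(x))|=1$ and $\|S-T\|<\varepsilon$. Let $c_0$ be the space of null sequences in $\mathbb{K}$ with the supremum norm, and let $\mathcal{Z}$ be the vector space $c_0$ equipped with the norm $$\|x\|_{\mathcal{Z}}=\|x\|_\infty+\left(\sum_{i=1}^\infty\frac{|x(i)|^2}{2^i}\right)^{1/2}.$$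 Theorem. The space $X=c_0\oplus_\infty\mathcal{Z}$, that is, $c_0\times\mathcal{Z}$ with the norm $\|(y,z)\|=\max\{\|y\|_\infty,\|z\|_{\mathcal{Z}}\}$, is a Banach space whose norm is strongly subdifferentiable, but $X$ fails the property $\mathbf{L}_{p,p}$-nu. -/

import Mathlib

open Filter Topology
open scoped ZeroAtInfty

/-! ### States, numerical radius, the local point property, strong subdifferentiability -/

section Properties

variable (𝕜 : Type*) [RCLike 𝕜] (X : Type*) [NormedAddCommGroup X] [NormedSpace 𝕜 X]

/-- The set `Π(X)` of states: pairs `(x, x*)` of norm-one elements of `X` and of its dual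
with `x*(x) = 1`. -/
def states : Set (X × StrongDual 𝕜 X) :=
  {p | ‖p.1‖ = 1 ∧ ‖p.2‖ = 1 ∧ p.2 p.1 = 1}

variable {𝕜 X} in
/-- The numerical radius `v(T) = sup {|x*(T x)| : (x, x*) ∈ Π(X)}`. The values are bounded by `‖T‖`,
and there is a state as soon as `X ≠ 0`, so the supremum is a genuine one. -/
noncomputable def numericalRadius (T : X →L[𝕜] X) : ℝ :=
  sSup {r : ℝ | ∃ p ∈ states 𝕜 X, r = ‖p.2 (T p.1)‖}

/-- The property `L_{p,p}`-nu (local Bishop-Phelps-Bollobás point property for the numerical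
radius): `η` depends on `ε` and on the state. -/
def HasLppNu : Prop :=
  ∀ ε : ℝ, 0 < ε → ∀ p ∈ states 𝕜 X, ∃ η : ℝ, 0 < η ∧
    ∀ T : X →L[𝕜] X, numericalRadius T = 1 → 1 - η < ‖p.2 (T p.1)‖ →
      ∃ S : X →L[𝕜] X, numericalRadius S = 1 ∧ ‖p.2 (S p.1)‖ = 1 ∧ ‖S - T‖ < ε

/-- The norm of `X` is strongly subdifferentiable: at every `x`, the one-sided limit of
`(‖x + t h‖ - ‖x‖) / t` as `t → 0+` (`t` real) exists uniformly for `h` in the closed unit ball. -/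
def HasSSDNorm : Prop :=
  ∀ x : X, ∃ L : X → ℝ,
    TendstoUniformlyOn (fun (t : ℝ) (h : X) => (‖x + (t : 𝕜) • h‖ - ‖x‖) / t) L
      (𝓝[>] 0) (Metric.closedBall 0 1)

end Properties

/-! ### The space `Z` -/

/-- The space `c₀` of null sequences of scalars, with the supremum norm. -/
abbrev SpaceC0 (𝕜 : Type*) [RCLike 𝕜] : Type _ := C₀(ℕ, 𝕜)

/-- The vector space underlying `Z` is that of `c₀`; it gets its own norm below. -/
def SpaceZ (𝕜 : Type*) [RCLike 𝕜] : Type _ := C₀(ℕ, 𝕜)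

namespace SpaceZ

variable {𝕜 : Type*} [RCLike 𝕜]

noncomputable instance : AddCommGroup (SpaceZ 𝕜) := inferInstanceAs (AddCommGroup C₀(ℕ, 𝕜))

noncomputable instance : Module 𝕜 (SpaceZ 𝕜) := inferInstanceAs (Module 𝕜 C₀(ℕ, 𝕜))

/-- The identity map from `Z` to `c₀`, as a linear isomorphism. -/
noncomputable def toC0 : SpaceZ 𝕜 ≃ₗ[𝕜] SpaceC0 𝕜 := LinearEquiv.refl 𝕜 C₀(ℕ, 𝕜)

/-- The norm of `Z`: `‖x‖_∞ + (∑ |x(i)|² / 2^i)^{1/2}`. Sequences are indexed from `0` here,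
so the weight of the coordinate `i : ℕ` is `1 / 2^(i+1)`. -/
noncomputable instance : Norm (SpaceZ 𝕜) where
  norm x := ‖toC0 x‖ + Real.sqrt (∑' i : ℕ, ‖toC0 x i‖ ^ 2 / 2 ^ (i + 1))

theorem norm_def (x : SpaceZ 𝕜) :
    ‖x‖ = ‖toC0 x‖ + Real.sqrt (∑' i : ℕ, ‖toC0 x i‖ ^ 2 / 2 ^ (i + 1)) := rfl

theorem norm_apply_le (y : SpaceC0 𝕜) (i : ℕ) : ‖y i‖ ≤ ‖y‖ := by
  have h := BoundedContinuousFunction.norm_coe_le_norm y.toBCF i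
  rwa [ZeroAtInftyContinuousMap.norm_toBCF_eq_norm] at h

theorem summable_weights (y : SpaceC0 𝕜) :
    Summable fun i : ℕ => ‖y i‖ ^ 2 / (2 : ℝ) ^ (i + 1) := by
  have hg : Summable fun i : ℕ => ‖y‖ ^ 2 / 2 * (1 / 2 : ℝ) ^ i :=
    summable_geometric_two.mul_left _
  refine Summable.of_nonneg_of_le (fun i => by positivity) (fun i => ?_) hg
  have h1 : ‖y i‖ ^ 2 ≤ ‖y‖ ^ 2 := by gcongr; exact norm_apply_le y i
  calc ‖y i‖ ^ 2 / (2 : ℝ) ^ (i + 1) ≤ ‖y‖ ^ 2 / (2 : ℝ) ^ (i + 1) := by gcongr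
    _ = ‖y‖ ^ 2 / 2 * (1 / 2 : ℝ) ^ i := by
      rw [pow_succ, one_div, inv_pow]; field_simp; ring

theorem sqrt_add_le (x y : SpaceC0 𝕜) :
    Real.sqrt (∑' i : ℕ, ‖(x + y) i‖ ^ 2 / 2 ^ (i + 1)) ≤
      Real.sqrt (∑' i : ℕ, ‖x i‖ ^ 2 / 2 ^ (i + 1)) +
        Real.sqrt (∑' i : ℕ, ‖y i‖ ^ 2 / 2 ^ (i + 1)) := by
  let w : SpaceC0 𝕜 → ℕ → ℝ := fun z i => ‖z i‖ / Real.sqrt (2 ^ (i + 1))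
  have hw : ∀ z i, w z i ^ (2 : ℝ) = ‖z i‖ ^ 2 / 2 ^ (i + 1) := by
    intro z i
    have h2 : (0 : ℝ) ≤ 2 ^ (i + 1) := by positivity
    simp only [w, Real.rpow_two, div_pow, Real.sq_sqrt h2]
  have hs : ∀ z, Summable fun i => w z i ^ (2 : ℝ) := by
    intro z; simpa only [hw] using summable_weights z
  have h0 : ∀ z i, 0 ≤ w z i := fun z i => by positivity
  have key := Real.Lp_add_le_tsum_of_nonneg (p := 2) (by norm_num) (h0 x) (h0 y) (hs x) (hs y)
  obtain ⟨hsum, hle⟩ := key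
  simp only [hw, ← Real.sqrt_eq_rpow] at hle
  refine le_trans (Real.sqrt_le_sqrt ?_) hle
  refine (summable_weights (x + y)).tsum_le_tsum (fun i => ?_) hsum
  rw [← hw]
  refine Real.rpow_le_rpow (h0 _ _) ?_ (by norm_num)
  simp only [w, ← add_div]
  gcongr
  exact norm_add_le _ _

theorem normCore : NormedSpace.Core 𝕜 (SpaceZ 𝕜) where
  norm_nonneg x := by rw [norm_def]; positivity
  norm_smul c x := by
    have h : ∀ i : ℕ, ‖toC0 (c • x) i‖ ^ 2 / (2 : ℝ) ^ (i + 1)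
        = ‖c‖ ^ 2 * (‖toC0 x i‖ ^ 2 / 2 ^ (i + 1)) := by
      intro i
      rw [map_smul, ZeroAtInftyContinuousMap.smul_apply, norm_smul]; ring
    rw [norm_def, norm_def, map_smul, norm_smul]
    simp only [← map_smul, h]
    rw [tsum_mul_left, Real.sqrt_mul (by positivity), Real.sqrt_sq (norm_nonneg c)]
    ring
  norm_triangle x y := by
    simp only [norm_def, map_add]
    have h1 := norm_add_le (toC0 x) (toC0 y)
    have h2 := sqrt_add_le (toC0 x) (toC0 y)
    linarith
  norm_eq_zero_iff x := by
    constructor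
    · intro h
      rw [norm_def] at h
      have h1 := norm_nonneg (toC0 x)
      have h2 := Real.sqrt_nonneg (∑' i : ℕ, ‖toC0 x i‖ ^ 2 / 2 ^ (i + 1))
      have h3 : ‖toC0 x‖ = 0 := by linarith
      exact (LinearEquiv.map_eq_zero_iff toC0).1 (norm_eq_zero.1 h3)
    · rintro rfl
      simp [norm_def]

noncomputable instance : NormedAddCommGroup (SpaceZ 𝕜) := NormedAddCommGroup.ofCore normCore

noncomputable instance : NormedSpace 𝕜 (SpaceZ 𝕜) := NormedSpace.ofCore normCore

end SpaceZ

/-- The space `X = c₀ ⊕_∞ Z`: the norm of a product is `‖(y, z)‖ = max ‖y‖ ‖z‖`. -/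
abbrev SpaceX (𝕜 : Type*) [RCLike 𝕜] : Type _ := SpaceC0 𝕜 × SpaceZ 𝕜

/-!
The norm of `Z` is equivalent to that of `c₀`, so `c₀ ⊕_∞ Z` is complete.

*Strong subdifferentiability.* The property at a point passes to sums, to maxima of finitely many
continuous functions (`SSDAt.max`), and to compositions with linear contractions, and the norm of
an inner product space has it (`SSDAt.norm_inner`). Near a nonzero point the sup norm is a finite
maximum of moduli of coordinates, so `c₀` has it; the norm of `Z` is the sum of the norm of `c₀`
and of a Hilbert norm composed with a contraction; and the norm of `c₀ ⊕_∞ Z` is a maximum of two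
such norms.

*Failure of the point property.* Let `z₀` be the normalization of `e₀` in `Z` and `z₀*` its support
functional, and consider the state `((e₀, z₀), (0, z₀*))`. Around `z₀` the norm of `Z` is smooth in
the directions `eₙ`, which gives explicit curves of states `(z(t), z*(t))` (`sphereCurve`,
`dualCurve`) through `(z₀, z₀*)`. Let `S` have numerical radius one and attain it at that state
with value `ω`, and put `v = S(eₘ, 0)_Z` with `m ≠ 0`. As `e₀ + s eₘ` stays in the unit ball of
`c₀` for all scalars `|s| ≤ 1`, the function
`t ↦ re (conj ω * z*(t) (S (e₀ + s eₘ, z(t))_Z))` has, once `v 0 = 0` is known, a maximum at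
`t = 0` for every such `s`. Its derivative vanishes there, and its dependence on `s` shows `v n = 0`.
Hence `v = 0` (`snd_apply_unitVec_eq_zero`). The operators `(y, z) ↦ (0, aₘ (y 0 e₀ + y m eₘ))`,
with `1 / aₘ` the norm of `e₀ + eₘ` in `Z`, have numerical radius one and values at the state
tending to one as `m → ∞`, while they map `(eₘ, 0)` to vectors of norm at least `1 / 2`. So they
stay at distance at least `1 / 2` from every such `S`.
-/

/-! ### Strong subdifferentiability at a point -/

section SSD

variable (𝕜 : Type*) [RCLike 𝕜] {X Y : Type*} [NormedAddCommGroup X] [NormedSpace 𝕜 X]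
  [NormedAddCommGroup Y] [NormedSpace 𝕜 Y]

/-- The function `φ` is strongly subdifferentiable at `x`: its one-sided directional derivatives
at `x` exist uniformly over the closed unit ball of directions. -/
def SSDAt (φ : X → ℝ) (x : X) : Prop :=
  ∃ L : X → ℝ, TendstoUniformlyOn (fun (t : ℝ) (h : X) => (φ (x + (t : 𝕜) • h) - φ x) / t) L
    (𝓝[>] 0) (Metric.closedBall 0 1)

variable {𝕜}

theorem eventually_forall_add_smul_mem {x : X} {U : Set X} (hU : U ∈ 𝓝 x) :
    ∀ᶠ t : ℝ in 𝓝[>] 0, ∀ h ∈ Metric.closedBall (0 : X) 1, x + (t : 𝕜) • h ∈ U := by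
  obtain ⟨δ, hδ, hU⟩ := Metric.mem_nhds_iff.1 hU
  filter_upwards [Ioo_mem_nhdsGT hδ] with t ht h hh
  apply hU
  rw [mem_ball_iff_norm, add_sub_cancel_left, norm_smul, RCLike.norm_ofReal, abs_of_pos ht.1]
  have : ‖h‖ ≤ 1 := by simpa using hh
  nlinarith [ht.1, ht.2]

namespace SSDAt

theorem congr {φ ψ : X → ℝ} {x : X} (hφ : SSDAt 𝕜 φ x) (h : φ =ᶠ[𝓝 x] ψ) : SSDAt 𝕜 ψ x := by
  obtain ⟨L, hL⟩ := hφ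
  refine ⟨L, hL.congr ?_⟩
  filter_upwards [eventually_forall_add_smul_mem (𝕜 := 𝕜) h] with t ht v hv
  have h1 : φ (x + (t : 𝕜) • v) = ψ (x + (t : 𝕜) • v) := ht v hv
  simp only [h1, h.eq_of_nhds]

theorem add {φ ψ : X → ℝ} {x : X} (hφ : SSDAt 𝕜 φ x) (hψ : SSDAt 𝕜 ψ x) :
    SSDAt 𝕜 (fun y => φ y + ψ y) x := by
  obtain ⟨L, hL⟩ := hφ
  obtain ⟨M, hM⟩ := hψ
  refine ⟨L + M, (hL.add hM).congr (Eventually.of_forall fun t h _ => ?_)⟩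
  simp only [Pi.add_apply]
  ring

theorem comp_contraction {φ : Y → ℝ} (A : X →ₗ[𝕜] Y) (hA : ∀ x, ‖A x‖ ≤ ‖x‖) {x : X}
    (hφ : SSDAt 𝕜 φ (A x)) : SSDAt 𝕜 (fun y => φ (A y)) x := by
  obtain ⟨L, hL⟩ := hφ
  refine ⟨fun h => L (A h), ((hL.comp A).mono fun h hh => ?_).congr
    (Eventually.of_forall fun t h _ => ?_)⟩
  · rw [mem_closedBall_zero_iff] at hh
    simpa using (hA h).trans hh
  · simp

theorem max {φ ψ : X → ℝ} {x : X} (hφ : SSDAt 𝕜 φ x) (hψ : SSDAt 𝕜 ψ x)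
    (cφ : Continuous φ) (cψ : Continuous ψ) : SSDAt 𝕜 (fun y => φ y ⊔ ψ y) x := by
  rcases lt_trichotomy (φ x) (ψ x) with h | h | h
  · refine hψ.congr ?_
    filter_upwards [cφ.continuousAt.eventually_lt cψ.continuousAt h] with y hy
    exact (max_eq_right hy.le).symm
  · obtain ⟨L, hL⟩ := hφ
    obtain ⟨M, hM⟩ := hψ
    refine ⟨fun v => L v ⊔ M v, ?_⟩
    rw [Metric.tendstoUniformlyOn_iff] at *
    intro ε hε
    filter_upwards [hL ε hε, hM ε hε, self_mem_nhdsWithin] with t h1 h2 ht v hv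
    have ht : 0 < t := ht
    have e : (φ (x + (t : 𝕜) • v) ⊔ ψ (x + (t : 𝕜) • v) - (φ x ⊔ ψ x)) / t
        = (φ (x + (t : 𝕜) • v) - φ x) / t ⊔ (ψ (x + (t : 𝕜) • v) - ψ x) / t := by
      rw [← h, sup_idem, max_div_div_right ht.le, max_sub_sub_right]
    rw [e, Real.dist_eq]
    exact (abs_max_sub_max_le_max _ _ _ _).trans_lt (max_lt (h1 v hv) (h2 v hv))
  · refine hφ.congr ?_
    filter_upwards [cψ.continuousAt.eventually_lt cφ.continuousAt h] with y hy
    exact (max_eq_left hy.le).symm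

theorem finset_sup' {ι : Type*} {φ : ι → X → ℝ} {x : X} {F : Finset ι} (hF : F.Nonempty)
    (hφ : ∀ i, SSDAt 𝕜 (φ i) x) (cφ : ∀ i, Continuous (φ i)) :
    SSDAt 𝕜 (fun y => F.sup' hF fun i => φ i y) x := by
  induction hF using Finset.Nonempty.cons_induction with
  | singleton i => simpa using hφ i
  | cons i s hi hs ih =>
    simp only [Finset.sup'_cons hs]
    exact (hφ i).max ih (cφ i) (Continuous.finset_sup'_apply hs fun i _ => cφ i)

/-- At the origin the difference quotients of a norm do not depend on `t`. -/
theorem norm_zero : SSDAt 𝕜 (fun y : X => ‖y‖) 0 := by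
  refine ⟨fun h => ‖h‖, ?_⟩
  rw [Metric.tendstoUniformlyOn_iff]
  intro ε hε
  filter_upwards [self_mem_nhdsWithin] with t ht v _
  have ht : 0 < t := ht
  simp [norm_smul, abs_of_pos ht, ht.ne', hε]

/-- With `N = ‖x + t h‖`, expanding `N ^ 2` shows that the difference quotient exceeds
`re ⟪x, h⟫ / ‖x‖` by `(t ^ 2 * ‖h‖ ^ 2 - (N - ‖x‖) ^ 2) / (2 * t * ‖x‖)`, which lies between `0`
and `t / (2 * ‖x‖)` on the unit ball. -/
theorem norm_inner {H : Type*} [NormedAddCommGroup H] [InnerProductSpace 𝕜 H] (x : H) :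
    SSDAt 𝕜 (fun y : H => ‖y‖) x := by
  rcases eq_or_ne x 0 with rfl | hx
  · exact norm_zero
  have hx : 0 < ‖x‖ := norm_pos_iff.2 hx
  refine ⟨fun h => RCLike.re (inner 𝕜 x h) / ‖x‖, ?_⟩
  rw [Metric.tendstoUniformlyOn_iff]
  intro ε hε
  filter_upwards [Ioo_mem_nhdsGT (show 0 < ε * ‖x‖ by positivity)] with t ht h hh
  have ht0 : 0 < t := ht.1
  have hh : ‖h‖ ≤ 1 := by simpa using hh
  have h1 := norm_add_sq (𝕜 := 𝕜) x ((t : 𝕜) • h)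
  rw [inner_smul_right, RCLike.re_ofReal_mul, norm_smul, RCLike.norm_ofReal, abs_of_pos ht0] at h1
  have h2 : |‖x + (t : 𝕜) • h‖ - ‖x‖| ≤ t * ‖h‖ := by
    have := abs_norm_sub_norm_le (x + (t : 𝕜) • h) x
    rwa [add_sub_cancel_left, norm_smul, RCLike.norm_ofReal, abs_of_pos ht0] at this
  have h2' := sq_le_sq' (neg_le_of_abs_le h2) (le_of_abs_le h2)
  set N := ‖x + (t : 𝕜) • h‖
  have e : (N - ‖x‖) / t - RCLike.re (inner 𝕜 x h) / ‖x‖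
      = ((t * ‖h‖) ^ 2 - (N - ‖x‖) ^ 2) / (2 * t * ‖x‖) := by
    field_simp
    linear_combination h1
  rw [dist_comm, Real.dist_eq, e, abs_of_nonneg (div_nonneg (by linarith) (by positivity)),
    div_lt_iff₀ (by positivity)]
  have h3 : (t * ‖h‖) ^ 2 ≤ t ^ 2 := by
    gcongr; nlinarith
  nlinarith [sq_nonneg (N - ‖x‖), ht.2, mul_pos hε hx]

end SSDAt

end SSD

/-! ### The norms of `c₀`, `Z` and `c₀ ⊕_∞ Z` -/

section SequenceSpaces

variable {𝕜 : Type*} [RCLike 𝕜]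

open SpaceZ

theorem norm_le_of_forall_apply_le {y : SpaceC0 𝕜} {C : ℝ} (hC : 0 ≤ C) (h : ∀ i, ‖y i‖ ≤ C) :
    ‖y‖ ≤ C := by
  rw [← ZeroAtInftyContinuousMap.norm_toBCF_eq_norm]
  exact (BoundedContinuousFunction.norm_le hC).2 h

/-- The evaluation of a null sequence at `i`. -/
noncomputable def evalC0 (i : ℕ) : StrongDual 𝕜 (SpaceC0 𝕜) :=
  LinearMap.mkContinuous
    { toFun := fun y => y i
      map_add' := fun _ _ => rfl
      map_smul' := fun _ _ => rfl } 1 fun y => by simpa using norm_apply_le y i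

theorem evalC0_apply (i : ℕ) (y : SpaceC0 𝕜) : evalC0 i y = y i := rfl

/-- Near a nonzero `x`, the sup norm is the maximum of finitely many coordinates. -/
theorem ssdAt_norm_spaceC0 (x : SpaceC0 𝕜) : SSDAt 𝕜 (fun y : SpaceC0 𝕜 => ‖y‖) x := by
  rcases eq_or_ne x 0 with rfl | hx
  · exact SSDAt.norm_zero
  have hx : 0 < ‖x‖ := norm_pos_iff.2 hx
  have hx0 : Tendsto x cofinite (𝓝 0) := by
    rw [← cocompact_eq_cofinite]; exact x.zero_at_infty'
  have hfin : {i | ¬ ‖x i‖ < ‖x‖ / 2}.Finite := by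
    have := (tendsto_norm_zero.comp hx0).eventually (gt_mem_nhds (half_pos hx))
    exact eventually_cofinite.1 this
  let F : Finset ℕ := insert 0 hfin.toFinset
  have hF : F.Nonempty := Finset.insert_nonempty _ _
  have hc : ∀ i : ℕ, ∀ y : SpaceC0 𝕜, ‖evalC0 i y‖ ≤ ‖y‖ := fun i y => norm_apply_le y i
  have main : SSDAt 𝕜 (fun y : SpaceC0 𝕜 => F.sup' hF fun i => ‖evalC0 i y‖) x := by
    refine SSDAt.finset_sup' hF (fun i => ?_) fun i => ?_
    · exact SSDAt.comp_contraction (φ := fun a : 𝕜 => ‖a‖) (evalC0 i).toLinearMap (hc i)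
        (SSDAt.norm_inner _)
    · exact (evalC0 i).continuous.norm
  refine main.congr ?_
  filter_upwards [Metric.ball_mem_nhds x (show 0 < ‖x‖ / 8 by positivity)] with y hy
  rw [mem_ball_iff_norm] at hy
  refine le_antisymm (Finset.sup'_le _ _ fun i _ => hc i y) ?_
  have h1 : ‖y‖ ≤ (F.sup' hF fun i => ‖evalC0 i y‖) ⊔ (5 / 8 * ‖x‖) := by
    refine norm_le_of_forall_apply_le (le_sup_of_le_right (by positivity)) fun i => ?_
    by_cases hi : i ∈ F
    · exact le_sup_of_le_left (Finset.le_sup' (fun i => ‖evalC0 i y‖) hi)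
    · have h2 : ‖x i‖ < ‖x‖ / 2 := by
        by_contra h
        exact hi (Finset.mem_insert_of_mem (hfin.mem_toFinset.2 h))
      have h3 := norm_apply_le (y - x) i
      have h4 : ‖y i‖ ≤ ‖x i‖ + ‖(y - x) i‖ := by
        simpa using norm_add_le (x i) ((y - x) i)
      exact le_sup_of_le_right (by linarith)
  rcases le_max_iff.1 h1 with h | h
  · exact h
  · have := norm_sub_norm_le x y
    rw [norm_sub_rev] at this
    linarith

theorem memℓp_weighted (y : SpaceC0 𝕜) :
    Memℓp (fun i : ℕ => ((Real.sqrt (2 ^ (i + 1)))⁻¹ : 𝕜) * y i) 2 := by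
  refine memℓp_gen ?_
  simpa [mul_pow, div_eq_inv_mul] using summable_weights y

/-- The weighted inclusion `x ↦ (x i / 2 ^ ((i + 1) / 2))` of `Z` into `ℓ²`; the second summand of
the norm of `Z` is the norm of the image. -/
noncomputable def toL2 : SpaceZ 𝕜 →ₗ[𝕜] lp (fun _ : ℕ => 𝕜) 2 where
  toFun x := ⟨_, memℓp_weighted (toC0 x)⟩
  map_add' x y := by ext i; exact mul_add _ (toC0 x i) (toC0 y i)
  map_smul' c x := by ext i; exact mul_left_comm _ c (toC0 x i)

theorem norm_toL2 (x : SpaceZ 𝕜) :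
    ‖toL2 x‖ = Real.sqrt (∑' i : ℕ, ‖toC0 x i‖ ^ 2 / 2 ^ (i + 1)) := by
  rw [lp.norm_eq_tsum_rpow (by norm_num), Real.sqrt_eq_rpow]
  simp [toL2, mul_pow, div_eq_inv_mul]

theorem norm_eq_add_norm_toL2 (x : SpaceZ 𝕜) : ‖x‖ = ‖toC0 x‖ + ‖toL2 x‖ := by
  rw [norm_toL2, norm_def]

theorem norm_toC0_le (x : SpaceZ 𝕜) : ‖toC0 x‖ ≤ ‖x‖ := by
  rw [norm_eq_add_norm_toL2]; linarith [norm_nonneg (toL2 x)]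

/-- The identity map from `Z` to `c₀`, as a contraction. -/
noncomputable def toC0CLM : SpaceZ 𝕜 →L[𝕜] SpaceC0 𝕜 :=
  toC0.toLinearMap.mkContinuous 1 (by simpa using norm_toC0_le)

theorem ssdAt_norm_spaceZ (x : SpaceZ 𝕜) : SSDAt 𝕜 (fun y : SpaceZ 𝕜 => ‖y‖) x := by
  simp only [norm_eq_add_norm_toL2]
  refine SSDAt.add ?_ ?_
  · exact SSDAt.comp_contraction (φ := fun y : SpaceC0 𝕜 => ‖y‖) toC0.toLinearMap norm_toC0_le
      (ssdAt_norm_spaceC0 _)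
  · refine SSDAt.comp_contraction (φ := fun y : lp (fun _ : ℕ => 𝕜) 2 => ‖y‖) toL2 (fun y => ?_)
      (SSDAt.norm_inner _)
    rw [norm_eq_add_norm_toL2]; linarith [norm_nonneg (toC0 y)]

theorem hasSSDNorm_spaceX : HasSSDNorm 𝕜 (SpaceX 𝕜) := by
  intro x
  refine SSDAt.max (φ := fun y : SpaceX 𝕜 => ‖y.1‖) (ψ := fun y : SpaceX 𝕜 => ‖y.2‖) ?_ ?_
    (by fun_prop) (by fun_prop)
  · exact SSDAt.comp_contraction (φ := fun y : SpaceC0 𝕜 => ‖y‖)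
      (LinearMap.fst 𝕜 (SpaceC0 𝕜) (SpaceZ 𝕜)) norm_fst_le (ssdAt_norm_spaceC0 _)
  · exact SSDAt.comp_contraction (φ := fun y : SpaceZ 𝕜 => ‖y‖)
      (LinearMap.snd 𝕜 (SpaceC0 𝕜) (SpaceZ 𝕜)) norm_snd_le (ssdAt_norm_spaceZ _)

theorem norm_le_two_mul_norm_toC0 (x : SpaceZ 𝕜) : ‖x‖ ≤ 2 * ‖toC0 x‖ := by
  have hg : Summable fun i : ℕ => ‖toC0 x‖ ^ 2 / 2 * (1 / 2 : ℝ) ^ i :=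
    summable_geometric_two.mul_left _
  have h : ∑' i : ℕ, ‖toC0 x i‖ ^ 2 / 2 ^ (i + 1) ≤ ‖toC0 x‖ ^ 2 := by
    calc ∑' i : ℕ, ‖toC0 x i‖ ^ 2 / 2 ^ (i + 1)
        ≤ ∑' i : ℕ, ‖toC0 x‖ ^ 2 / 2 * (1 / 2 : ℝ) ^ i := by
          refine (summable_weights (toC0 x)).tsum_le_tsum (fun i => ?_) hg
          calc ‖toC0 x i‖ ^ 2 / (2 : ℝ) ^ (i + 1) ≤ ‖toC0 x‖ ^ 2 / (2 : ℝ) ^ (i + 1) := by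
                gcongr; exact norm_apply_le _ i
            _ = ‖toC0 x‖ ^ 2 / 2 * (1 / 2 : ℝ) ^ i := by
                rw [pow_succ, one_div, inv_pow]; field_simp; ring
      _ = ‖toC0 x‖ ^ 2 := by rw [tsum_mul_left, tsum_geometric_two]; ring
  have := Real.sqrt_le_sqrt h
  rw [Real.sqrt_sq (norm_nonneg _)] at this
  rw [norm_def]; linarith

instance : CompleteSpace (SpaceZ 𝕜) := by
  have hanti : AntilipschitzWith 2 (toC0CLM (𝕜 := 𝕜)) :=
    AddMonoidHomClass.antilipschitz_of_bound toC0CLM norm_le_two_mul_norm_toC0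
  have hemb := hanti.isUniformInducing (toC0CLM (𝕜 := 𝕜)).uniformContinuous
  refine (completeSpace_congr (e := toC0.toEquiv) ⟨hemb, toC0.injective⟩).2 inferInstance

end SequenceSpaces

/-! ### States and the numerical radius -/

section NumericalRadius

variable {𝕜 : Type*} [RCLike 𝕜] {X Y Z : Type*} [NormedAddCommGroup X] [NormedSpace 𝕜 X]
  [NormedAddCommGroup Y] [NormedSpace 𝕜 Y] [NormedAddCommGroup Z] [NormedSpace 𝕜 Z]

theorem norm_apply_state_le (T : X →L[𝕜] X) {p : X × StrongDual 𝕜 X} (hp : p ∈ states 𝕜 X) :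
    ‖p.2 (T p.1)‖ ≤ ‖T‖ := by
  obtain ⟨h1, h2, -⟩ := hp
  calc ‖p.2 (T p.1)‖ ≤ ‖p.2‖ * (‖T‖ * ‖p.1‖) :=
        (p.2.le_opNorm _).trans (by gcongr; exact T.le_opNorm _)
    _ = ‖T‖ := by rw [h1, h2]; ring

theorem norm_apply_state_le_numericalRadius (T : X →L[𝕜] X) {p : X × StrongDual 𝕜 X}
    (hp : p ∈ states 𝕜 X) : ‖p.2 (T p.1)‖ ≤ numericalRadius T := by
  refine le_csSup ⟨‖T‖, ?_⟩ ⟨p, hp, rfl⟩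
  rintro _ ⟨q, hq, rfl⟩
  exact norm_apply_state_le T hq

theorem numericalRadius_eq_one {T : X →L[𝕜] X} (hT : ‖T‖ ≤ 1) {p : X × StrongDual 𝕜 X}
    (hp : p ∈ states 𝕜 X) (h : p.2 (T p.1) = 1) : numericalRadius T = 1 := by
  refine le_antisymm (csSup_le ⟨_, p, hp, rfl⟩ ?_) ?_
  · rintro _ ⟨q, hq, rfl⟩
    exact (norm_apply_state_le T hq).trans hT
  · simpa [h] using norm_apply_state_le_numericalRadius T hp

/-- In an `ℓ∞`-sum, a state of the second summand extends to a state of the sum, with any point of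
the unit ball as first coordinate. -/
theorem mem_states_prod {y : Y} {z : Z} {f : StrongDual 𝕜 Z} (hy : ‖y‖ ≤ 1) (hz : ‖z‖ = 1)
    (hf : ∀ w, ‖f w‖ ≤ ‖w‖) (hfz : f z = 1) :
    ((y, z), f.comp (ContinuousLinearMap.snd 𝕜 Y Z)) ∈ states 𝕜 (Y × Z) := by
  have hyz : ‖(y, z)‖ = 1 := by rw [Prod.norm_mk, hz, max_eq_right hy]
  have hval : f.comp (ContinuousLinearMap.snd 𝕜 Y Z) (y, z) = 1 := by simpa using hfz
  refine ⟨hyz, le_antisymm ?_ ?_, hval⟩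
  · refine ContinuousLinearMap.opNorm_le_bound _ zero_le_one fun w => ?_
    rw [one_mul]
    exact (hf w.2).trans (norm_snd_le w)
  · have := (f.comp (ContinuousLinearMap.snd 𝕜 Y Z)).le_opNorm (y, z)
    rwa [hyz, hval, norm_one, mul_one] at this

end NumericalRadius

/-! ### A smooth curve of states of `Z` -/

section Counterexample

variable {𝕜 : Type*} [RCLike 𝕜]

open SpaceZ

/-- The unit vectors of `c₀`. -/
noncomputable def unitVec (i : ℕ) : SpaceC0 𝕜 where
  toFun := Pi.single i 1
  continuous_toFun := continuous_of_discreteTopology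
  zero_at_infty' := by
    rw [cocompact_eq_cofinite]
    refine tendsto_nhds_of_eventually_eq ?_
    filter_upwards [(Set.finite_singleton i).compl_mem_cofinite] with j hj
    exact Pi.single_eq_of_ne hj 1

theorem unitVec_apply (i j : ℕ) : (unitVec i : SpaceC0 𝕜) j = if j = i then 1 else 0 :=
  Pi.single_apply i 1 j

/-- The evaluation at `i`, as a continuous functional on `Z`. -/
noncomputable def evalZ (i : ℕ) : StrongDual 𝕜 (SpaceZ 𝕜) :=
  (evalC0 i).comp toC0CLM

theorem evalZ_apply (i : ℕ) (x : SpaceZ 𝕜) : evalZ i x = toC0 x i := rfl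

/-- The element of `Z` with value `a` at `0` and `b` at `n`, and `0` elsewhere. -/
noncomputable def twoPoint (n : ℕ) (a b : 𝕜) : SpaceZ 𝕜 :=
  a • toC0.symm (unitVec 0) + b • toC0.symm (unitVec n)

theorem toC0_twoPoint_apply (n : ℕ) (a b : 𝕜) (i : ℕ) :
    toC0 (twoPoint n a b) i = a * (if i = 0 then 1 else 0) + b * (if i = n then 1 else 0) := by
  simp [twoPoint, unitVec_apply]

theorem norm_twoPoint {n : ℕ} (hn : n ≠ 0) (a b : 𝕜) :
    ‖twoPoint n a b‖ = max ‖a‖ ‖b‖ + Real.sqrt (‖a‖ ^ 2 / 2 + ‖b‖ ^ 2 / 2 ^ (n + 1)) := by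
  have h0 : toC0 (twoPoint n a b) 0 = a := by simp [toC0_twoPoint_apply, hn.symm]
  have h1 : toC0 (twoPoint n a b) n = b := by simp [toC0_twoPoint_apply, hn]
  have h2 : ∀ i, i ≠ 0 → i ≠ n → toC0 (twoPoint n a b) i = 0 := fun i hi hi' => by
    simp [toC0_twoPoint_apply, hi, hi']
  rw [norm_def]
  congr 1
  · refine le_antisymm (norm_le_of_forall_apply_le (by positivity) fun i => ?_) (max_le ?_ ?_)
    · by_cases hi : i = 0
      · rw [hi, h0]; exact le_max_left _ _
      by_cases hi' : i = n
      · rw [hi', h1]; exact le_max_right _ _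
      rw [h2 i hi hi', norm_zero]; positivity
    · simpa only [h0] using norm_apply_le (toC0 (twoPoint n a b)) 0
    · simpa only [h1] using norm_apply_le (toC0 (twoPoint n a b)) n
  · rw [tsum_eq_sum (s := {0, n}), Finset.sum_pair hn.symm, h0, h1]
    · norm_num
    · intro i hi
      simp only [Finset.mem_insert, Finset.mem_singleton, not_or] at hi
      simp [h2 i hi.1 hi.2]

theorem le_norm_of_pair {n : ℕ} (hn : n ≠ 0) (w : SpaceZ 𝕜) :
    ‖toC0 w 0‖ + Real.sqrt (‖toC0 w 0‖ ^ 2 / 2 + ‖toC0 w n‖ ^ 2 / 2 ^ (n + 1)) ≤ ‖w‖ := by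
  rw [norm_def]
  refine add_le_add (norm_apply_le _ 0) (Real.sqrt_le_sqrt ?_)
  have := (summable_weights (toC0 w)).sum_le_tsum {0, n} fun i _ => by positivity
  rw [Finset.sum_pair hn.symm] at this
  simpa using this

/-- The weighted `ℓ²` norm of `(1, t)`, the values being at the coordinates `0` and `n`. -/
noncomputable def pairNorm (n : ℕ) (t : ℝ) : ℝ := Real.sqrt (1 / 2 + t ^ 2 / 2 ^ (n + 1))

theorem pairNorm_sq (n : ℕ) (t : ℝ) : pairNorm n t ^ 2 = 1 / 2 + t ^ 2 / 2 ^ (n + 1) :=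
  Real.sq_sqrt (by positivity)

theorem pairNorm_pos (n : ℕ) (t : ℝ) : 0 < pairNorm n t := Real.sqrt_pos.2 (by positivity)

theorem differentiable_pairNorm (n : ℕ) : Differentiable ℝ (pairNorm n) := by
  unfold pairNorm
  exact Differentiable.sqrt (by fun_prop) fun t => by positivity

/-- The functional supporting the unit ball of `Z` in the direction `twoPoint n 1 t`, for
`|t| ≤ 1`. For `|t| < 1` it is the gradient of the norm of `Z`, which in this plane is smooth
there, the sup norm being attained at the coordinate `0` only. -/
noncomputable def dualCurve (n : ℕ) (t : ℝ) : StrongDual 𝕜 (SpaceZ 𝕜) :=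
  ((1 + 1 / (2 * pairNorm n t) : ℝ) : 𝕜) • evalZ 0
    + ((t / (2 ^ (n + 1) * pairNorm n t) : ℝ) : 𝕜) • evalZ n

theorem dualCurve_apply (n : ℕ) (t : ℝ) (w : SpaceZ 𝕜) :
    dualCurve n t w = ((1 + 1 / (2 * pairNorm n t) : ℝ) : 𝕜) * toC0 w 0
      + ((t / (2 ^ (n + 1) * pairNorm n t) : ℝ) : 𝕜) * toC0 w n := by
  simp [dualCurve, evalZ_apply]

/-- The weighted `ℓ²` part is bounded by the Cauchy-Schwarz inequality in two coordinates. -/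
theorem norm_dualCurve_apply_le {n : ℕ} (hn : n ≠ 0) (t : ℝ) (w : SpaceZ 𝕜) :
    ‖dualCurve n t w‖ ≤ ‖w‖ := by
  refine le_trans ?_ (le_norm_of_pair hn w)
  rw [dualCurve_apply]
  have hN := pairNorm_pos n t
  have hN2 := pairNorm_sq n t
  set N := pairNorm n t
  set p := ‖toC0 w 0‖ with hp
  set q := ‖toC0 w n‖ with hq
  have hk : (0 : ℝ) < 2 ^ (n + 1) := by positivity
  set k : ℝ := 2 ^ (n + 1)
  have h1 : (p / 2 + |t| * q / k) / N ≤ Real.sqrt (p ^ 2 / 2 + q ^ 2 / k) := by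
    rw [div_le_iff₀ hN]
    refine (sq_le_sq₀ (by positivity) (by positivity)).1 ?_
    rw [mul_pow, hN2, Real.sq_sqrt (by positivity)]
    have e : (p ^ 2 / 2 + q ^ 2 / k) * (1 / 2 + t ^ 2 / k) - (p / 2 + |t| * q / k) ^ 2
        = (|t| * p - q) ^ 2 / (2 * k) := by
      rw [← sq_abs t]
      field_simp
      ring
    have : 0 ≤ (|t| * p - q) ^ 2 / (2 * k) := by positivity
    linarith
  calc _ ≤ (1 + 1 / (2 * N)) * p + |t| / (k * N) * q := by
        refine (norm_add_le _ _).trans_eq ?_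
        rw [norm_mul, norm_mul, RCLike.norm_ofReal, RCLike.norm_ofReal, abs_div,
          abs_of_pos (show 0 < k * N by positivity),
          abs_of_pos (show 0 < 1 + 1 / (2 * N) by positivity)]
    _ = p + (p / 2 + |t| * q / k) / N := by field_simp; ring
    _ ≤ _ := by gcongr

/-- The normalization of `twoPoint n 1 t`. -/
noncomputable def sphereCurve (n : ℕ) (t : ℝ) : SpaceZ 𝕜 :=
  (((1 + pairNorm n t)⁻¹ : ℝ) : 𝕜) • twoPoint n 1 (t : 𝕜)

theorem norm_sphereCurve {n : ℕ} (hn : n ≠ 0) {t : ℝ} (ht : |t| ≤ 1) :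
    ‖(sphereCurve n t : SpaceZ 𝕜)‖ = 1 := by
  have hN := pairNorm_pos n t
  rw [sphereCurve, norm_smul, norm_twoPoint hn, RCLike.norm_ofReal, RCLike.norm_ofReal, norm_one,
    max_eq_left ht, sq_abs, one_pow, abs_of_pos (by positivity)]
  exact inv_mul_cancel₀ (by positivity)

theorem dualCurve_sphereCurve {n : ℕ} (hn : n ≠ 0) (t : ℝ) :
    dualCurve n t (sphereCurve n t : SpaceZ 𝕜) = 1 := by
  have hN := pairNorm_pos n t
  have hN2 := pairNorm_sq n t
  have h : (1 + pairNorm n t)⁻¹ * ((1 + 1 / (2 * pairNorm n t)) * 1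
      + t / (2 ^ (n + 1) * pairNorm n t) * t) = 1 := by
    field_simp at hN2 ⊢
    linear_combination -hN2
  rw [sphereCurve, map_smul, dualCurve_apply, toC0_twoPoint_apply, toC0_twoPoint_apply]
  simp only [hn, hn.symm, if_true, if_false, mul_one, mul_zero, add_zero, zero_add, smul_eq_mul]
  have h' := congrArg (fun r : ℝ => (r : 𝕜)) h
  push_cast at h' ⊢
  simpa using h'

theorem norm_unitVec_add_smul_le {m : ℕ} (hm : m ≠ 0) {s : 𝕜} (hs : ‖s‖ ≤ 1) :
    ‖(unitVec 0 + s • unitVec m : SpaceC0 𝕜)‖ ≤ 1 := by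
  refine norm_le_of_forall_apply_le zero_le_one fun i => ?_
  rw [ZeroAtInftyContinuousMap.add_apply, ZeroAtInftyContinuousMap.smul_apply, unitVec_apply,
    unitVec_apply]
  by_cases hi : i = 0
  · simp [hi, hm.symm]
  · by_cases hi' : i = m <;> simp [hi, hi', hm, hs]

theorem mem_states_sphereCurve {m n : ℕ} (hm : m ≠ 0) (hn : n ≠ 0) {s : 𝕜} (hs : ‖s‖ ≤ 1) {t : ℝ}
    (ht : |t| ≤ 1) :
    (((unitVec 0 + s • unitVec m, sphereCurve n t) : SpaceX 𝕜),
      (dualCurve n t).comp (ContinuousLinearMap.snd 𝕜 (SpaceC0 𝕜) (SpaceZ 𝕜)))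
        ∈ states 𝕜 (SpaceX 𝕜) :=
  mem_states_prod (norm_unitVec_add_smul_le hm hs) (norm_sphereCurve hn ht)
    (norm_dualCurve_apply_le hn t) (dualCurve_sphereCurve hn t)

theorem sphereCurve_zero (n : ℕ) : (sphereCurve n 0 : SpaceZ 𝕜) = sphereCurve 1 0 := by
  simp [sphereCurve, twoPoint, pairNorm]

theorem dualCurve_zero (n : ℕ) : (dualCurve n 0 : StrongDual 𝕜 (SpaceZ 𝕜)) = dualCurve 1 0 := by
  ext w
  simp [dualCurve_apply, pairNorm]

/-- The values of an operator along `sphereCurve`, tested against `dualCurve`, are a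
differentiable function of the parameter. -/
theorem differentiable_re_dualCurve (S : SpaceX 𝕜 →L[𝕜] SpaceX 𝕜) (ω : 𝕜) (n : ℕ) :
    Differentiable ℝ fun t : ℝ =>
      RCLike.re (starRingEnd 𝕜 ω * dualCurve n t (S (unitVec 0, sphereCurve n t)).2) := by
  have hN : ∀ t, pairNorm n t ≠ 0 := fun t => (pairNorm_pos n t).ne'
  have hN' : ∀ t, 1 + pairNorm n t ≠ 0 := fun t => by have := pairNorm_pos n t; positivity
  have hdN := differentiable_pairNorm n
  set A := (S (unitVec 0, 0)).2
  set B := (S (0, toC0.symm (unitVec 0))).2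
  set C := (S (0, toC0.symm (unitVec n))).2
  have hS : ∀ t : ℝ, (S (unitVec 0, sphereCurve n t)).2
      = A + (((1 + pairNorm n t)⁻¹ : ℝ) : 𝕜) • (B + (t : 𝕜) • C) := by
    intro t
    have e : ((unitVec 0, sphereCurve n t) : SpaceX 𝕜) = (unitVec 0, 0)
        + (((1 + pairNorm n t)⁻¹ : ℝ) : 𝕜) • ((0, toC0.symm (unitVec 0))
          + (t : 𝕜) • (0, toC0.symm (unitVec n))) := by
      simp [sphereCurve, twoPoint]
    rw [e]
    simp only [map_add, map_smul]
    rfl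
  let a : SpaceZ 𝕜 → ℕ → ℝ := fun w i => RCLike.re (starRingEnd 𝕜 ω * toC0 w i)
  have e : ∀ t : ℝ, RCLike.re (starRingEnd 𝕜 ω * dualCurve n t (S (unitVec 0, sphereCurve n t)).2)
      = (1 + 1 / (2 * pairNorm n t)) * (a A 0 + (1 + pairNorm n t)⁻¹ * (a B 0 + t * a C 0))
        + t / (2 ^ (n + 1) * pairNorm n t)
          * (a A n + (1 + pairNorm n t)⁻¹ * (a B n + t * a C n)) := by
    intro t
    rw [hS, dualCurve_apply]
    generalize 1 + 1 / (2 * pairNorm n t) = r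
    generalize (1 + pairNorm n t)⁻¹ = ρ
    generalize t / (2 ^ (n + 1) * pairNorm n t) = q
    simp only [map_add, map_smul, ZeroAtInftyContinuousMap.add_apply,
      ZeroAtInftyContinuousMap.smul_apply, smul_eq_mul]
    have expand : ∀ c α β γ α' β' γ' : 𝕜,
        c * ((r : 𝕜) * (α + (ρ : 𝕜) * (β + (t : 𝕜) * γ))
            + (q : 𝕜) * (α' + (ρ : 𝕜) * (β' + (t : 𝕜) * γ')))
          = (r : 𝕜) * (c * α + (ρ : 𝕜) * (c * β + (t : 𝕜) * (c * γ)))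
            + (q : 𝕜) * (c * α' + (ρ : 𝕜) * (c * β' + (t : 𝕜) * (c * γ'))) := by
      intros; ring
    rw [expand]
    simp only [a, map_add, RCLike.re_ofReal_mul]
  simp only [e]
  have h2 : ∀ t, 2 * pairNorm n t ≠ 0 := fun t => mul_ne_zero two_ne_zero (hN t)
  have h3 : ∀ t, 2 ^ (n + 1) * pairNorm n t ≠ 0 := fun t => mul_ne_zero (by positivity) (hN t)
  fun_prop (disch := assumption)

/-! ### Operators attaining their numerical radius at `(e₀, z₀, z₀*)` -/

/-- If `S` has numerical radius one and attains it at the state `(e₀, z₀, z₀*)`, where `z₀` is the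
normalization of `e₀` in `Z`, then the `Z`-component of `S` kills every `(eₘ, 0)` with `m ≠ 0`. -/
theorem snd_apply_unitVec_eq_zero {S : SpaceX 𝕜 →L[𝕜] SpaceX 𝕜} (hS : numericalRadius S = 1)
    (hp : ‖dualCurve 1 0 (S (unitVec 0, sphereCurve 1 0)).2‖ = 1) {m : ℕ} (hm : m ≠ 0) :
    (S (unitVec m, 0)).2 = 0 := by
  set v := (S (unitVec m, 0)).2 with hv
  set ω := dualCurve 1 0 (S (unitVec 0, sphereCurve 1 0)).2 with hω
  have key : ∀ {n : ℕ}, n ≠ 0 → ∀ {s : 𝕜}, ‖s‖ ≤ 1 → ∀ {t : ℝ}, |t| ≤ 1 →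
      RCLike.re (starRingEnd 𝕜 ω * dualCurve n t (S (unitVec 0, sphereCurve n t)).2)
        + RCLike.re (starRingEnd 𝕜 ω * (s * dualCurve n t v)) ≤ 1 := by
    intro n hn s hs t ht
    have h := norm_apply_state_le_numericalRadius S (mem_states_sphereCurve hm hn hs ht)
    have e : ((unitVec 0 + s • unitVec m, sphereCurve n t) : SpaceX 𝕜)
        = (unitVec 0, sphereCurve n t) + s • (unitVec m, 0) := by simp
    simp only [e, map_add, map_smul, hS] at h
    rw [← map_add, ← mul_add]
    refine (RCLike.re_le_norm _).trans ?_
    rw [norm_mul, RCLike.norm_conj, hp, one_mul]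
    simpa using h
  have hωω : RCLike.re (starRingEnd 𝕜 ω * ω) = 1 := by
    rw [RCLike.conj_mul, hp]; simp
  -- It is enough to test against the scalar that makes the second term of `key` its modulus.
  have test : ∀ {a : 𝕜}, (∀ s : 𝕜, ‖s‖ ≤ 1 → RCLike.re (starRingEnd 𝕜 ω * (s * a)) ≤ 0) →
      a = 0 := by
    intro a h
    by_contra ha
    have ha' : 0 < ‖a‖ := norm_pos_iff.2 ha
    have h1 := h (ω * starRingEnd 𝕜 a * ((‖a‖⁻¹ : ℝ) : 𝕜)) (by
      simp [hp, ha'.ne'])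
    have e : starRingEnd 𝕜 ω * (ω * starRingEnd 𝕜 a * ((‖a‖⁻¹ : ℝ) : 𝕜) * a)
        = ((‖ω‖ ^ 2 * ‖a‖⁻¹ * ‖a‖ ^ 2 : ℝ) : 𝕜) := by
      have h2 := RCLike.conj_mul ω
      have h3 := RCLike.conj_mul a
      push_cast
      rw [← h2, ← h3]; ring
    rw [e, RCLike.ofReal_re, hp] at h1
    have : 0 < 1 ^ 2 * ‖a‖⁻¹ * ‖a‖ ^ 2 := by positivity
    linarith
  have hv0 : toC0 v 0 = 0 := by
    have h : dualCurve 1 0 v = 0 := test fun s hs => by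
      have := key one_ne_zero hs (t := 0) (by simp)
      rw [← hω, hωω] at this
      linarith
    rw [dualCurve_apply] at h
    have hN := pairNorm_pos 1 0
    have hne : ((1 + 1 / (2 * pairNorm 1 0) : ℝ) : 𝕜) ≠ 0 := by
      exact_mod_cast (show (0 : ℝ) < 1 + 1 / (2 * pairNorm 1 0) by positivity).ne'
    simpa only [zero_div, RCLike.ofReal_zero, zero_mul, add_zero, mul_eq_zero, hne, false_or]
      using h
  -- For `n ≠ 0`, the first-order conditions at `t = 0` for `s = 0` and for general `s` are compared.
  have hvn : ∀ n : ℕ, toC0 v n = 0 := by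
    intro n
    rcases eq_or_ne n 0 with rfl | hn
    · exact hv0
    have hN := pairNorm_pos n 0
    set g : ℝ → ℝ := fun t =>
      RCLike.re (starRingEnd 𝕜 ω * dualCurve n t (S (unitVec 0, sphereCurve n t)).2) with hg
    have hg0 : g 0 = 1 := by
      simp only [hg]
      rw [sphereCurve_zero, dualCurve_zero, ← hω, hωω]
    have hd : HasDerivAt g (deriv g 0) 0 :=
      (differentiable_re_dualCurve S ω n).differentiableAt.hasDerivAt
    have hnear : ∀ᶠ t : ℝ in 𝓝 0, |t| ≤ 1 := by
      filter_upwards [Metric.closedBall_mem_nhds (0 : ℝ) one_pos] with t ht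
      simpa using ht
    have hg' : deriv g 0 = 0 := by
      refine IsLocalMax.hasDerivAt_eq_zero ?_ hd
      filter_upwards [hnear] with t ht
      have := key hn (s := 0) (by simp) ht
      rw [zero_mul, mul_zero, map_zero, add_zero] at this
      rwa [hg0]
    have hq : HasDerivAt (fun t : ℝ => t / (2 ^ (n + 1) * pairNorm n t))
        ((1 * (2 ^ (n + 1) * pairNorm n 0) - 0 * (2 ^ (n + 1) * deriv (pairNorm n) 0))
          / (2 ^ (n + 1) * pairNorm n 0) ^ 2) 0 :=
      (hasDerivAt_id (0 : ℝ)).div ((differentiable_pairNorm n 0).hasDerivAt.const_mul _)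
        (by positivity)
    refine test fun s hs => ?_
    have hsum := hd.add (hq.mul_const (RCLike.re (starRingEnd 𝕜 ω * (s * toC0 v n))))
    have h0 := IsLocalMax.hasDerivAt_eq_zero (by
      filter_upwards [hnear] with t ht
      have h := key hn hs ht
      have e : RCLike.re (starRingEnd 𝕜 ω * (s * dualCurve n t v))
          = t / (2 ^ (n + 1) * pairNorm n t)
            * RCLike.re (starRingEnd 𝕜 ω * (s * toC0 v n)) := by
        rw [dualCurve_apply, hv0, mul_zero, zero_add, ← RCLike.re_ofReal_mul]
        congr 1; ring
      rw [e] at h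
      simpa only [Pi.add_apply, hg0, zero_div, zero_mul, add_zero] using h) hsum
    rw [hg', zero_mul, sub_zero, zero_add, one_mul] at h0
    refine ((mul_eq_zero.1 h0).resolve_left ?_).le
    positivity
  have : toC0 v = 0 := by ext n; exact hvn n
  exact (LinearEquiv.map_eq_zero_iff toC0).1 this

/-! ### Operators almost attaining their numerical radius there -/

/-- The operator `(y, z) ↦ (0, a (y 0 e₀ + y m eₘ))`. -/
noncomputable def pairOperator (m : ℕ) (a : ℝ) : SpaceX 𝕜 →L[𝕜] SpaceX 𝕜 :=
  (a : 𝕜) • (ContinuousLinearMap.inr 𝕜 (SpaceC0 𝕜) (SpaceZ 𝕜)).comp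
    (((evalC0 0).comp (ContinuousLinearMap.fst 𝕜 (SpaceC0 𝕜) (SpaceZ 𝕜))).smulRight
        (toC0.symm (unitVec 0) : SpaceZ 𝕜)
      + ((evalC0 m).comp (ContinuousLinearMap.fst 𝕜 (SpaceC0 𝕜) (SpaceZ 𝕜))).smulRight
        (toC0.symm (unitVec m) : SpaceZ 𝕜))

theorem pairOperator_apply (m : ℕ) (a : ℝ) (x : SpaceX 𝕜) :
    pairOperator m a x = (0, (a : 𝕜) • twoPoint m (x.1 0) (x.1 m)) := by
  simp [pairOperator, twoPoint, evalC0_apply]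

/-- The norm of `e₀ + eₘ` in `Z`. -/
noncomputable def pairConst (m : ℕ) : ℝ := 1 + pairNorm m 1

theorem norm_twoPoint_le {m : ℕ} (hm : m ≠ 0) {a b : 𝕜} {C : ℝ} (ha : ‖a‖ ≤ C) (hb : ‖b‖ ≤ C) :
    ‖twoPoint m a b‖ ≤ pairConst m * C := by
  have hC : 0 ≤ C := (norm_nonneg a).trans ha
  have e : pairConst m * C = C + Real.sqrt (C ^ 2 / 2 + C ^ 2 / 2 ^ (m + 1)) := by
    rw [show C ^ 2 / 2 + C ^ 2 / 2 ^ (m + 1) = C ^ 2 * (1 / 2 + 1 ^ 2 / 2 ^ (m + 1)) by ring,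
      Real.sqrt_mul (sq_nonneg C), Real.sqrt_sq hC, pairConst, pairNorm]
    ring
  rw [norm_twoPoint hm, e]
  refine add_le_add (max_le ha hb) (Real.sqrt_le_sqrt ?_)
  gcongr

theorem norm_twoPoint_one_one {m : ℕ} (hm : m ≠ 0) :
    ‖(twoPoint m 1 1 : SpaceZ 𝕜)‖ = pairConst m := by
  rw [norm_twoPoint hm, pairConst, pairNorm]
  simp

theorem pairConst_pos (m : ℕ) : 0 < pairConst m := by
  have := pairNorm_pos m 1
  unfold pairConst; positivity

theorem pairConst_le_two (m : ℕ) : pairConst m ≤ 2 := by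
  have h : pairNorm m 1 ≤ 1 := by
    refine Real.sqrt_le_one.2 ?_
    have : (2 : ℝ) ≤ 2 ^ (m + 1) := by
      simpa using pow_le_pow_right₀ (one_le_two (α := ℝ)) (Nat.le_add_left 1 m)
    have : (1 : ℝ) ^ 2 / 2 ^ (m + 1) ≤ 1 / 2 := by rw [one_pow]; gcongr
    linarith
  unfold pairConst; linarith

theorem numericalRadius_pairOperator {m : ℕ} (hm : m ≠ 0) :
    numericalRadius (pairOperator m (pairConst m)⁻¹ : SpaceX 𝕜 →L[𝕜] SpaceX 𝕜) = 1 := by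
  have hc := pairConst_pos m
  set z : SpaceZ 𝕜 := (((pairConst m)⁻¹ : ℝ) : 𝕜) • twoPoint m 1 1 with hzdef
  have hz : ‖z‖ = 1 := by
    rw [norm_smul, norm_twoPoint_one_one hm, RCLike.norm_ofReal, abs_of_pos (by positivity)]
    exact inv_mul_cancel₀ hc.ne'
  obtain ⟨f, hf, hfz⟩ := exists_dual_vector 𝕜 z (norm_ne_zero_iff.1 (by simp [hz]))
  have hy : ‖(unitVec 0 + (1 : 𝕜) • unitVec m : SpaceC0 𝕜)‖ ≤ 1 :=
    norm_unitVec_add_smul_le hm norm_one.le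
  refine numericalRadius_eq_one ?_ (mem_states_prod (f := f) hy hz (fun w => ?_) ?_) ?_
  · refine ContinuousLinearMap.opNorm_le_bound _ zero_le_one fun x => ?_
    have hx : ∀ i, ‖x.1 i‖ ≤ ‖x‖ := fun i => (norm_apply_le x.1 i).trans (norm_fst_le x)
    rw [pairOperator_apply, Prod.norm_mk, norm_zero, max_eq_right (norm_nonneg _), norm_smul,
      RCLike.norm_ofReal, abs_of_pos (inv_pos.2 hc), one_mul, inv_mul_le_iff₀ hc]
    exact norm_twoPoint_le hm (hx 0) (hx m)
  · simpa [hf] using f.le_opNorm w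
  · rw [hfz, hz]; simp
  · have e : twoPoint m ((unitVec 0 + (1 : 𝕜) • unitVec m : SpaceC0 𝕜) 0)
        ((unitVec 0 + (1 : 𝕜) • unitVec m : SpaceC0 𝕜) m) = twoPoint m 1 1 := by
      simp [unitVec_apply, hm, hm.symm]
    simp only [pairOperator_apply, e, ContinuousLinearMap.comp_apply,
      ContinuousLinearMap.coe_snd']
    rw [← hzdef, hfz, hz]; simp

theorem tendsto_pairConst : Tendsto pairConst atTop (𝓝 (1 + pairNorm 1 0)) := by
  unfold pairConst pairNorm
  refine tendsto_const_nhds.add ?_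
  have h : Tendsto (fun m : ℕ => (1 : ℝ) ^ 2 / 2 ^ (m + 1)) atTop (𝓝 0) := by
    have := (tendsto_pow_atTop_nhds_zero_of_lt_one (r := (1 / 2 : ℝ)) (by norm_num)
      (by norm_num)).comp (tendsto_add_atTop_nat 1)
    refine this.congr fun m => ?_
    simp
  have h' := (h.const_add (1 / 2)).sqrt
  rwa [show (1 / 2 + 0 : ℝ) = 1 / 2 + 0 ^ 2 / 2 ^ (1 + 1) by norm_num] at h'

theorem norm_dualCurve_pairOperator {m : ℕ} (hm : m ≠ 0) {a : ℝ} (ha : 0 ≤ a) (z : SpaceZ 𝕜) :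
    ‖dualCurve 1 0 (pairOperator m a ((unitVec 0, z) : SpaceX 𝕜)).2‖ = (1 + pairNorm 1 0) * a := by
  have hN := pairNorm_pos 1 0
  have hN2 := pairNorm_sq 1 0
  have e : 1 + 1 / (2 * pairNorm 1 0) = 1 + pairNorm 1 0 := by
    field_simp
    linear_combination (-2) * hN2
  -- `e` holds because `pairNorm 1 0` is the square root of `1 / 2`.
  rw [pairOperator_apply, map_smul, dualCurve_apply, e]
  simp only [toC0_twoPoint_apply, unitVec_apply]
  simp only [hm, hm.symm, if_true, if_false, mul_one, mul_zero, add_zero, zero_div,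
    RCLike.ofReal_zero, zero_mul]
  rw [norm_smul, RCLike.norm_ofReal, RCLike.norm_ofReal, abs_of_nonneg ha,
    abs_of_pos (by positivity), mul_comm]

theorem le_norm_pairOperator_apply {m : ℕ} (hm : m ≠ 0) {a : ℝ} (ha : 0 ≤ a) :
    a ≤ ‖(pairOperator m a ((unitVec m, 0) : SpaceX 𝕜)).2‖ := by
  refine le_trans ?_ ((norm_apply_le _ m).trans (norm_toC0_le _))
  rw [pairOperator_apply, map_smul, ZeroAtInftyContinuousMap.smul_apply, toC0_twoPoint_apply]
  simp [unitVec_apply, hm, abs_of_nonneg ha]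

theorem not_hasLppNu_spaceX : ¬ HasLppNu 𝕜 (SpaceX 𝕜) := by
  intro H
  have hp := mem_states_sphereCurve (𝕜 := 𝕜) one_ne_zero one_ne_zero (s := 0) (t := 0)
    (by simp) (by simp)
  rw [zero_smul, add_zero] at hp
  obtain ⟨η, hη, h⟩ := H (1 / 4) (by norm_num) _ hp
  have hc0 : 1 + pairNorm 1 0 ≠ 0 := by have := pairNorm_pos 1 0; positivity
  have hlim : Tendsto (fun m => (1 + pairNorm 1 0) * (pairConst m)⁻¹) atTop (𝓝 1) := by
    simpa [hc0] using (tendsto_pairConst.inv₀ hc0).const_mul (1 + pairNorm 1 0)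
  obtain ⟨m, hm1, hm⟩ := ((hlim.eventually (lt_mem_nhds (sub_lt_self 1 hη))).and
    (eventually_ne_atTop 0)).exists
  have ha : 0 ≤ (pairConst m)⁻¹ := (inv_pos.2 (pairConst_pos m)).le
  obtain ⟨S, hS, hSp, hST⟩ := h (pairOperator m (pairConst m)⁻¹)
    (numericalRadius_pairOperator hm) (hm1.trans_eq (norm_dualCurve_pairOperator hm ha _).symm)
  have hzero := snd_apply_unitVec_eq_zero hS hSp hm
  have h1 := le_norm_pairOperator_apply (𝕜 := 𝕜) hm ha
  have h2 : ‖(S - pairOperator m (pairConst m)⁻¹ : SpaceX 𝕜 →L[𝕜] SpaceX 𝕜) (unitVec m, 0)‖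
      ≤ 1 / 4 * 1 := by
    refine (ContinuousLinearMap.le_opNorm _ _).trans
      (mul_le_mul hST.le ?_ (norm_nonneg _) (by norm_num))
    rw [Prod.norm_mk, norm_zero]
    refine max_le (norm_le_of_forall_apply_le zero_le_one fun i => ?_) zero_le_one
    rw [unitVec_apply]; split_ifs <;> simp
  have h3 := (norm_snd_le _).trans h2
  rw [sub_apply, Prod.snd_sub, hzero, zero_sub, norm_neg] at h3
  have h4 : (2 : ℝ)⁻¹ ≤ (pairConst m)⁻¹ := inv_anti₀ (pairConst_pos m) (pairConst_le_two m)
  norm_num at h3 h4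
  linarith

end Counterexample

theorem theorem3p9 (𝕜 : Type*) [RCLike 𝕜] :
    CompleteSpace (SpaceX 𝕜) ∧ HasSSDNorm 𝕜 (SpaceX 𝕜) ∧ ¬ HasLppNu 𝕜 (SpaceX 𝕜) :=
  ⟨inferInstance, hasSSDNorm_spaceX, not_hasLppNu_spaceX⟩
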